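/- For a finite non-empty simple undirected graph $G=(V,E)$, let $\mathcal{MG}$ be the random matching returned by the greedy algorithm: starting from the edge set $E$ and the empty matching, as long as edges remain, choose one of the remaining edges uniformly at random, add it to the matching, and delete it together with all remaining edges sharing an end node with it. For integers $r,g$ let $G(g,r)$ be the family of all finite non-empty simple $r$-regular graphs of girth (length of a shortest cycle) at least $g$. Then for every integer $r\ge 3$, $$\lim_{g\to\infty}\ \inf_{G\in G(g,r)}\mathbb{E}\left[\frac{|\mathcal{MG}|}{|V|}\right]=\lim_{g\to\infty}\ \sup_{G\in G(g,r)}\mathbb{E}\left[\frac{|\mathcal{MG}|}{|V|}\right]=\frac{1-(r-1)^{-\frac{r}{r-2}}}{2}.$$ As a result, $$\lim_{r\to\infty}\lim_{g\to\infty}\ \inf_{G\in G(g,r)}\mathbb{E}\left[\frac{|\mathcal{MG}|}{|V|}\right]=\lim_{r\to\infty}\lim_{g\to\infty}\ \sup_{G\in G(g,r)}\mathbb{E}\left[\frac{|\mathcal{MG}|}{|V|}\right]=\frac12,$$ which is the value of $|M|/|V|$ for a perfect matching $M$: greedy finds a nearly perfect matching when both the degree and the girth are large. -/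

import Mathlib

open Filter Topology

namespace GreedyMatching

/-- The edges of `S` that survive after `e` has been chosen: those with no end node in common
with `e` (in particular `e` itself is removed). -/
def deleteIncident {V : Type*} [Fintype V] [DecidableEq V]
    (S : Finset (Sym2 V)) (e : Sym2 V) : Finset (Sym2 V) :=
  S.filter fun f => ¬ ∃ v, v ∈ e ∧ v ∈ f

theorem card_deleteIncident_lt {V : Type*} [Fintype V] [DecidableEq V]
    (S : Finset (Sym2 V)) (e : Sym2 V) (he : e ∈ S) :
    (deleteIncident S e).card < S.card := by
  refine Finset.card_lt_card (Finset.filter_ssubset.2 ⟨e, he, ?_⟩)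
  induction e with
  | _ a b => exact fun h => h ⟨a, by simp⟩

/-- The law of the set of edges selected by the randomized greedy algorithm when the remaining
edges are those of `S`: if `S` is empty, stop; otherwise choose an edge `e` of `S` uniformly at
random, delete all the edges incident to `e`, continue with the remaining edges, and add `e` to
the outcome. -/
noncomputable def greedyFrom {V : Type*} [Fintype V] [DecidableEq V]
    (S : Finset (Sym2 V)) : PMF (Finset (Sym2 V)) :=
  if h : S.Nonempty then
    (PMF.uniformOfFinset S.attach (Finset.attach_nonempty_iff.2 h)).bind fun e =>
      (greedyFrom (deleteIncident S e.1)).map (insert e.1)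
  else PMF.pure ∅
termination_by S.card
decreasing_by exact card_deleteIncident_lt S e.1 e.2

/-- The law of the random matching returned by the greedy algorithm on the finite graph `G`. -/
noncomputable def greedyMatching {V : Type*} [Fintype V] [DecidableEq V]
    (G : SimpleGraph V) [DecidableRel G.Adj] : PMF (Finset (Sym2 V)) :=
  greedyFrom G.edgeFinset

/-- The expectation of the number of edges of the greedy matching divided by the number of
nodes. -/
noncomputable def expectedRatio {V : Type*} [Fintype V] [DecidableEq V]
    (G : SimpleGraph V) [DecidableRel G.Adj] : ℝ :=
  ∑ M : Finset (Sym2 V), (greedyMatching G M).toReal * ((M.card : ℝ) / (Fintype.card V : ℝ))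

open Classical in
/-- The values of the expected ratio over the family of all (finite, non-empty, simple)
`r`-regular graphs of girth at least `g`. Every finite graph is isomorphic to one whose nodes
form a type in the lowest universe. -/
def ratios (g r : ℕ) : Set ℝ :=
  {x | ∃ (V : Type) (_ : Fintype V) (_ : Nonempty V) (G : SimpleGraph V),
    G.IsRegularOfDegree r ∧ (g : ℕ∞) ≤ G.egirth ∧ x = expectedRatio G}

/-- The infimum of the expected ratio over `r`-regular graphs of girth at least `g`. -/
noncomputable def infRatio (g r : ℕ) : ℝ := sInf (ratios g r)

/-- The supremum of the expected ratio over `r`-regular graphs of girth at least `g`. -/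
noncomputable def supRatio (g r : ℕ) : ℝ := sSup (ratios g r)

end GreedyMatching

namespace GreedyMatching

/-! Greedy amounts to offering the edges in uniformly random order, or at independent uniform times
in [0, 1]. `freeAt S A u` is the probability that `A` is still uncovered at time `u`. An edge `e`
meeting `A` and arriving at time `u` spoils this exactly when all of `A ∪ e` is uncovered by the
other edges. So the derivative is minus a sum of the same quantities for `S.erase e` and `A ∪ e`
(`hasDerivAt_freeAt`).

If the girth is large, a connected set of `k` nodes induces a tree and has `k (r - 2) + 2` boundary
edges (`IsExplored.step`). The system becomes `p_k' = -(k (r - 2) + 2) p_{k+1}`, `p_k(0) = 1`,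
solved by `p_k(u) = (1 + (r - 2) u)^(-(k + 2/(r - 2)))`, which is `limitProb`. At `k = u = 1` this
is the limiting fraction of uncovered nodes, `(r - 1)^(-r/(r - 2))`.

The girth only gives the system up to a finite level `K`, where the trivial error bound 1 is used.
Over a short time interval, a comparison system that grows like `2^k` in the level `k` absorbs this
error (`abs_freeAt_sub_limitProb_le`); finitely many intervals cover [0, 1]. Cayley graphs show that
the families of graphs are non-empty. -/

theorem sum_powerset_sum_mem {α : Type*} [DecidableEq α] (S : Finset α) (h : Finset α → α → ℝ) :
    ∑ R ∈ S.powerset, ∑ e ∈ R, h (R.erase e) e = ∑ e ∈ S, ∑ R ∈ (S.erase e).powerset, h R e := by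
  rw [Finset.sum_comm' (t' := S) (s' := fun e => S.powerset.filter (e ∈ ·))
    (by intro R e; simp only [Finset.mem_filter, Finset.mem_powerset]; grind)]
  refine Finset.sum_congr rfl fun e he => ?_
  refine Finset.sum_nbij' (fun R => R.erase e) (fun R => insert e R) ?_ ?_ ?_ ?_ ?_
  · intro R hR; simp only [Finset.mem_filter, Finset.mem_powerset] at *; grind
  · intro R hR; simp only [Finset.mem_filter, Finset.mem_powerset] at *; grind
  · intro R hR; simp only [Finset.mem_filter] at hR; exact Finset.insert_erase hR.2
  · intro R hR
    simp only [Finset.mem_powerset] at hR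
    exact Finset.erase_insert fun h => by simpa using hR h
  · intro R _; rfl

/-- With `sum_powerset_sum_mem`, this puts both halves of the derivative of `freeAt` over the same
index set: an edge `e` and a subset of `S.erase e`. -/
theorem sum_powerset_sum_notMem {α : Type*} [DecidableEq α] (S : Finset α) (h : Finset α → ℝ) :
    ∑ R ∈ S.powerset, ∑ _e ∈ S \ R, h R = ∑ e ∈ S, ∑ R ∈ (S.erase e).powerset, h R :=
  Finset.sum_comm' (by intro R e; simp only [Finset.mem_sdiff, Finset.mem_powerset]; grind)

/-! ### Greedy expectations; first-edge and last-edge decompositions -/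

section Greedy

variable {V : Type*} [Fintype V] [DecidableEq V]

/-- The expectation of `F` under the greedy matching of the edges in `R`. -/
noncomputable def expect (R : Finset (Sym2 V)) (F : Finset (Sym2 V) → ℝ) : ℝ :=
  ∑ M : Finset (Sym2 V), (greedyFrom R M).toReal * F M

theorem expect_empty (F : Finset (Sym2 V) → ℝ) : expect ∅ F = F ∅ := by
  unfold expect
  rw [Finset.sum_eq_single ∅]
  · rw [greedyFrom]; simp
  · intro M _ hM
    rw [greedyFrom]; simp [hM]
  · simp

theorem greedyFrom_toReal {R : Finset (Sym2 V)} (hR : R.Nonempty) (M : Finset (Sym2 V)) :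
    (greedyFrom R M).toReal = ∑ e : {x // x ∈ R}, (R.card : ℝ)⁻¹ *
      ∑ N, if M = insert e.1 N then (greedyFrom (deleteIncident R e.1) N).toReal else 0 := by
  rw [greedyFrom, dif_pos hR, PMF.bind_apply, tsum_fintype, ENNReal.toReal_sum]
  · refine Finset.sum_congr rfl fun e _ => ?_
    rw [ENNReal.toReal_mul, PMF.uniformOfFinset_apply_of_mem _ (Finset.mem_attach R e),
      PMF.map_apply, tsum_fintype, ENNReal.toReal_sum]
    · rw [ENNReal.toReal_inv, ENNReal.toReal_natCast, Finset.card_attach]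
      simp only [apply_ite ENNReal.toReal, ENNReal.toReal_zero]
      congr!
    · intro N _
      split_ifs
      · exact PMF.apply_ne_top _ _
      · simp
  · intro e _
    refine ENNReal.mul_ne_top (PMF.apply_ne_top _ _) (PMF.apply_ne_top _ _)

/-- Decomposition with respect to the first edge. -/
theorem card_mul_expect (R : Finset (Sym2 V)) (F : Finset (Sym2 V) → ℝ) :
    (R.card : ℝ) * expect R F =
      ∑ e ∈ R, expect (deleteIncident R e) (fun M => F (insert e M)) := by
  rcases R.eq_empty_or_nonempty with rfl | hR
  · simp
  have hc : (R.card : ℝ) ≠ 0 := by exact_mod_cast hR.card_pos.ne'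
  rw [← Finset.sum_coe_sort R]
  unfold expect
  simp_rw [greedyFrom_toReal hR, ← Finset.mul_sum]
  rw [Finset.mul_sum]
  simp_rw [mul_assoc, mul_inv_cancel_left₀ hc, Finset.sum_mul]
  rw [Finset.sum_comm]
  refine Finset.sum_congr rfl fun e _ => ?_
  rw [Finset.sum_comm]
  refine Finset.sum_congr rfl fun N _ => ?_
  simp [ite_mul]

theorem mem_deleteIncident {S : Finset (Sym2 V)} {e f : Sym2 V} :
    f ∈ deleteIncident S e ↔ f ∈ S ∧ ¬ ∃ v, v ∈ e ∧ v ∈ f := by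
  simp [deleteIncident]

theorem deleteIncident_subset (S : Finset (Sym2 V)) (e : Sym2 V) : deleteIncident S e ⊆ S :=
  Finset.filter_subset _ _

theorem notMem_deleteIncident_self (S : Finset (Sym2 V)) (e : Sym2 V) :
    e ∉ deleteIncident S e := by
  induction e with
  | _ a b => exact fun h => (mem_deleteIncident.1 h).2 ⟨a, by simp⟩

theorem deleteIncident_erase (S : Finset (Sym2 V)) (e f : Sym2 V) :
    deleteIncident (S.erase e) f = (deleteIncident S f).erase e := by
  ext x; simp only [mem_deleteIncident, Finset.mem_erase]; tauto

/-- The expectation only depends on the values at the matchings contained in `R`. -/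
theorem expect_congr {R : Finset (Sym2 V)} {F F' : Finset (Sym2 V) → ℝ}
    (h : ∀ M ⊆ R, (∀ e ∈ M, ∀ f ∈ M, e ≠ f → ¬ ∃ v, v ∈ e ∧ v ∈ f) → F M = F' M) :
    expect R F = expect R F' := by
  induction hn : R.card using Nat.strong_induction_on generalizing R F F' with
  | _ n ih =>
  rcases R.eq_empty_or_nonempty with rfl | hR
  · simpa [expect_empty] using h ∅ (by simp) (by simp)
  have hc : (R.card : ℝ) ≠ 0 := by exact_mod_cast hR.card_pos.ne'
  apply mul_left_cancel₀ hc
  rw [card_mul_expect, card_mul_expect]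
  refine Finset.sum_congr rfl fun e he => ?_
  refine ih _ (hn ▸ card_deleteIncident_lt R e he) (fun M hM hd => ?_) rfl
  have key : ∀ f ∈ M, ¬ ∃ v, v ∈ e ∧ v ∈ f := fun f hf => (mem_deleteIncident.1 (hM hf)).2
  refine h _ (Finset.insert_subset he (hM.trans (deleteIncident_subset R e))) ?_
  intro x hx y hy hxy
  rcases Finset.mem_insert.1 hx with hx | hx <;> rcases Finset.mem_insert.1 hy with hy | hy
  · exact absurd (hx.trans hy.symm) hxy
  · exact hx ▸ key y hy
  · exact fun ⟨v, h1, h2⟩ => key x hx ⟨v, hy ▸ h2, h1⟩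
  · exact hd x hx y hy hxy

theorem expect_const (R : Finset (Sym2 V)) (c : ℝ) : expect R (fun _ => c) = c := by
  induction hn : R.card using Nat.strong_induction_on generalizing R with
  | _ n ih =>
  rcases R.eq_empty_or_nonempty with rfl | hR
  · simp [expect_empty]
  have hc : (R.card : ℝ) ≠ 0 := by exact_mod_cast hR.card_pos.ne'
  apply mul_left_cancel₀ hc
  rw [card_mul_expect, Finset.sum_congr rfl fun e he =>
    ih _ (hn ▸ card_deleteIncident_lt R e he) _ rfl]
  simp

theorem expect_mono (R : Finset (Sym2 V)) {F F' : Finset (Sym2 V) → ℝ} (h : ∀ M, F M ≤ F' M) :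
    expect R F ≤ expect R F' :=
  Finset.sum_le_sum fun M _ => mul_le_mul_of_nonneg_left (h M) ENNReal.toReal_nonneg

/-- The probability that greedy on `R` leaves all the nodes of `A` uncovered. -/
noncomputable def freeProb (R : Finset (Sym2 V)) (A : Finset V) : ℝ :=
  expect R fun M => if ∀ e ∈ M, ¬ ∃ v ∈ A, v ∈ e then 1 else 0

theorem freeProb_empty (A : Finset V) : freeProb ∅ A = 1 := by
  simp [freeProb, expect_empty]

theorem freeProb_nonneg (R : Finset (Sym2 V)) (A : Finset V) : 0 ≤ freeProb R A := by
  rw [← expect_const R 0]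
  refine expect_mono R fun M => ?_
  split_ifs <;> norm_num

theorem freeProb_le_one (R : Finset (Sym2 V)) (A : Finset V) : freeProb R A ≤ 1 := by
  conv_rhs => rw [← expect_const R 1]
  refine expect_mono R fun M => ?_
  split_ifs <;> norm_num

theorem card_mul_freeProb (R : Finset (Sym2 V)) (A : Finset V) :
    (R.card : ℝ) * freeProb R A =
      ∑ f ∈ R, if ∃ v ∈ A, v ∈ f then 0 else freeProb (deleteIncident R f) A := by
  rw [freeProb, card_mul_expect]
  refine Finset.sum_congr rfl fun f _ => ?_
  split_ifs with hf
  · conv_rhs => rw [← expect_const (deleteIncident R f) 0]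
    refine congrArg _ (funext fun M => if_neg fun h => h f (Finset.mem_insert_self f M) hf)
  · refine congrArg _ (funext fun M => ?_)
    exact if_congr (by rw [Finset.forall_mem_insert]; exact and_iff_right hf) rfl rfl

/-- The change of `freeProb` when the edge `e` is offered after all the edges of `R`. -/
noncomputable def freeProbSnoc (R : Finset (Sym2 V)) (A : Finset V) (e : Sym2 V) : ℝ :=
  freeProb R A - if ∃ v ∈ A, v ∈ e then freeProb R (A ∪ e.toFinset) else 0

/-- First-edge decomposition for greedy on `R.erase e` followed by `e`: if the first edge `f` meets
`e`, then `e` is blocked and offering it last has no effect. -/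
theorem card_mul_freeProbSnoc {R : Finset (Sym2 V)} (A : Finset V) {e : Sym2 V} :
    ((R.erase e).card : ℝ) * freeProbSnoc (R.erase e) A e =
      ∑ f ∈ R.erase e, if ∃ v ∈ A, v ∈ f then 0 else
        if ∃ v, v ∈ f ∧ v ∈ e then freeProb (deleteIncident R f) A
          else freeProbSnoc ((deleteIncident R f).erase e) A e := by
  have hU : ∀ f : Sym2 V, (∃ v ∈ A ∪ e.toFinset, v ∈ f) ↔
      (∃ v ∈ A, v ∈ f) ∨ ∃ v, v ∈ f ∧ v ∈ e := by
    intro f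
    simp only [Finset.mem_union, Sym2.mem_toFinset, or_and_right, exists_or]
    simp only [and_comm]
  have hE : ∀ f : Sym2 V, (∃ v, v ∈ f ∧ v ∈ e) →
      (deleteIncident R f).erase e = deleteIncident R f := fun f hf =>
    Finset.erase_eq_of_notMem fun h => (mem_deleteIncident.1 h).2 hf
  rw [freeProbSnoc, mul_sub, card_mul_freeProb]
  by_cases he : ∃ v ∈ A, v ∈ e
  · rw [if_pos he, card_mul_freeProb, ← Finset.sum_sub_distrib]
    refine Finset.sum_congr rfl fun f _ => ?_
    simp only [hU, deleteIncident_erase]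
    by_cases h1 : ∃ v ∈ A, v ∈ f
    · simp only [h1, true_or, if_true, sub_zero]
    · by_cases h2 : ∃ v, v ∈ f ∧ v ∈ e
      · simp only [h1, h2, hE f h2, or_true, if_true, if_false, sub_zero]
      · simp only [h1, h2, or_false, if_false, freeProbSnoc, he, if_true]
  · rw [if_neg he, mul_zero, sub_zero]
    refine Finset.sum_congr rfl fun f _ => ?_
    simp only [deleteIncident_erase]
    by_cases h1 : ∃ v ∈ A, v ∈ f
    · simp only [h1, if_true]
    · by_cases h2 : ∃ v, v ∈ f ∧ v ∈ e
      · simp only [h1, h2, hE f h2, if_true, if_false]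
      · simp only [h1, h2, if_false, freeProbSnoc, he, sub_zero]

/-- Decomposition with respect to the last edge. -/
theorem card_mul_freeProb_eq_sum_snoc (R : Finset (Sym2 V)) (A : Finset V) :
    (R.card : ℝ) * freeProb R A = ∑ e ∈ R, freeProbSnoc (R.erase e) A e := by
  induction hn : R.card using Nat.strong_induction_on generalizing R with
  | _ n ih =>
  subst hn
  rcases R.eq_empty_or_nonempty with rfl | hR
  · simp
  -- The general case cancels the factor `R.card - 1`, the number of edges left besides the last
  -- one.
  by_cases h1 : R.card = 1
  · obtain ⟨e, rfl⟩ := Finset.card_eq_one.1 h1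
    rw [card_mul_freeProb]
    have hd : deleteIncident {e} e = ∅ := by
      refine Finset.eq_empty_of_forall_notMem fun x hx => ?_
      obtain rfl : x = e := by simpa using deleteIncident_subset _ _ hx
      exact notMem_deleteIncident_self _ _ hx
    simp only [Finset.sum_singleton, hd, freeProb_empty, Finset.erase_singleton, freeProbSnoc]
    split_ifs <;> norm_num
  have hc : (R.card : ℝ) - 1 ≠ 0 := by
    rw [sub_ne_zero]; exact_mod_cast h1
  have hcard : ∀ e ∈ R, ((R.erase e).card : ℝ) = R.card - 1 := fun e he => by
    rw [Finset.card_erase_of_mem he, Nat.cast_sub (Finset.card_pos.2 ⟨e, he⟩), Nat.cast_one]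
  apply mul_left_cancel₀ hc
  rw [card_mul_freeProb, Finset.mul_sum, Finset.mul_sum]
  have hsnoc : ∑ e ∈ R, ((R.card : ℝ) - 1) * freeProbSnoc (R.erase e) A e =
      ∑ e ∈ R, ∑ f ∈ R.erase e, if ∃ v ∈ A, v ∈ f then 0 else
        if ∃ v, v ∈ f ∧ v ∈ e then freeProb (deleteIncident R f) A
          else freeProbSnoc ((deleteIncident R f).erase e) A e :=
    Finset.sum_congr rfl fun e he => by rw [← hcard e he, card_mul_freeProbSnoc]
  rw [hsnoc]
  -- Exchange the last edge `e` with the first edge `f`. For fixed `f`, the `e` that meet `f` give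
  -- equal terms and the others sum up by induction; together they count `R.card - 1` copies.
  rw [Finset.sum_comm' (t' := R) (s' := fun f => R.erase f)
    (by intro x y; simp only [Finset.mem_erase]; tauto)]
  refine Finset.sum_congr rfl fun f hf => ?_
  by_cases hA : ∃ v ∈ A, v ∈ f
  · simp only [hA, if_true, mul_zero, Finset.sum_const_zero]
  simp only [hA, if_false]
  rw [Finset.sum_ite, Finset.sum_const, nsmul_eq_mul]
  have hfil : (R.erase f).filter (fun e => ¬ ∃ v, v ∈ f ∧ v ∈ e) = deleteIncident R f := by
    rw [Finset.filter_erase]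
    exact Finset.erase_eq_of_notMem (notMem_deleteIncident_self R f)
  rw [hfil, ← ih _ (card_deleteIncident_lt R f hf) _ rfl, ← add_mul, ← hcard f hf]
  congr 1
  rw [← Nat.cast_add, ← hfil, Finset.card_filter_add_card_filter_not]

/-! ### Independent arrivals and the differential equation -/

/-- The probability that all nodes of `A` are uncovered when each edge of `S` arrives
independently with probability `u`, and greedy runs on the set of the edges that arrive. -/
noncomputable def freeAt (S : Finset (Sym2 V)) (A : Finset V) (u : ℝ) : ℝ :=
  ∑ R ∈ S.powerset, u ^ R.card * (1 - u) ^ (S.card - R.card) * freeProb R A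

theorem freeAt_zero (S : Finset (Sym2 V)) (A : Finset V) : freeAt S A 0 = 1 := by
  rw [freeAt, Finset.sum_eq_single ∅]
  · simp [freeProb_empty]
  · intro R _ hR
    simp [hR]
  · simp

theorem freeAt_one (S : Finset (Sym2 V)) (A : Finset V) : freeAt S A 1 = freeProb S A := by
  rw [freeAt, Finset.sum_eq_single S]
  · simp
  · intro R hR hRS
    have := Finset.card_lt_card ((Finset.mem_powerset.1 hR).ssubset_of_ne hRS)
    rw [sub_self, zero_pow (by omega)]; ring
  · simp

theorem freeAt_nonneg (S : Finset (Sym2 V)) (A : Finset V) {u : ℝ} (h0 : 0 ≤ u) (h1 : u ≤ 1) :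
    0 ≤ freeAt S A u :=
  Finset.sum_nonneg fun R _ => mul_nonneg
    (mul_nonneg (pow_nonneg h0 _) (pow_nonneg (sub_nonneg.2 h1) _)) (freeProb_nonneg R A)

theorem freeAt_le_one (S : Finset (Sym2 V)) (A : Finset V) {u : ℝ} (h0 : 0 ≤ u) (h1 : u ≤ 1) :
    freeAt S A u ≤ 1 := by
  have h := Finset.sum_pow_mul_eq_add_pow u (1 - u) S
  rw [add_sub_cancel, one_pow] at h
  rw [← h]
  exact Finset.sum_le_sum fun R _ => mul_le_of_le_one_right
    (mul_nonneg (pow_nonneg h0 _) (pow_nonneg (sub_nonneg.2 h1) _)) (freeProb_le_one R A)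

/-- Differentiating `u ^ R.card` produces `R.card * freeProb R A`, which the last-edge decomposition
resolves; differentiating the power of `1 - u` produces one copy of `freeProb R A` per edge of `S \
R`. For each `e` the two differ only by the effect of offering `e` last. -/
theorem hasDerivAt_freeAt (S : Finset (Sym2 V)) (A : Finset V) (u : ℝ) :
    HasDerivAt (freeAt S A)
      (-∑ e ∈ S with ∃ v ∈ A, v ∈ e, freeAt (S.erase e) (A ∪ e.toFinset) u) u := by
  have hd : HasDerivAt (freeAt S A) (∑ R ∈ S.powerset,
      ((R.card * u ^ (R.card - 1)) * (1 - u) ^ (S.card - R.card) +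
        u ^ R.card * (((S.card - R.card : ℕ) : ℝ) * (1 - u) ^ (S.card - R.card - 1) * (-1)))
        * freeProb R A) u := by
    unfold freeAt
    refine HasDerivAt.fun_sum fun R _ => HasDerivAt.mul_const ?_ _
    exact (hasDerivAt_pow _ u).mul (((hasDerivAt_id u).const_sub 1).pow _)
  convert hd using 1
  have hsplit : ∀ R ∈ S.powerset,
      ((R.card * u ^ (R.card - 1)) * (1 - u) ^ (S.card - R.card) +
        u ^ R.card * (((S.card - R.card : ℕ) : ℝ) * (1 - u) ^ (S.card - R.card - 1) * (-1)))
        * freeProb R A =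
      ∑ e ∈ R, u ^ (R.erase e).card * (1 - u) ^ (S.card - 1 - (R.erase e).card)
        * freeProbSnoc (R.erase e) A e
      - ∑ e ∈ S \ R, u ^ R.card * (1 - u) ^ (S.card - 1 - R.card) * freeProb R A := by
    intro R hR
    have h1 : ∑ e ∈ R, u ^ (R.erase e).card * (1 - u) ^ (S.card - 1 - (R.erase e).card)
        * freeProbSnoc (R.erase e) A e = ∑ e ∈ R, u ^ (R.card - 1) * (1 - u) ^ (S.card - R.card)
          * freeProbSnoc (R.erase e) A e := by
      refine Finset.sum_congr rfl fun e he => ?_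
      have := Finset.card_pos.2 ⟨e, he⟩
      rw [Finset.card_erase_of_mem he, show S.card - 1 - (R.card - 1) = S.card - R.card by omega]
    rw [h1, ← Finset.mul_sum, ← card_mul_freeProb_eq_sum_snoc, Finset.sum_const, nsmul_eq_mul,
      Finset.card_sdiff_of_subset (Finset.mem_powerset.1 hR), Nat.sub_right_comm]
    ring
  rw [Finset.sum_congr rfl hsplit, Finset.sum_sub_distrib, sum_powerset_sum_mem S
    fun R e => u ^ R.card * (1 - u) ^ (S.card - 1 - R.card) * freeProbSnoc R A e,
    sum_powerset_sum_notMem S fun R => u ^ R.card * (1 - u) ^ (S.card - 1 - R.card) * freeProb R A,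
    ← Finset.sum_sub_distrib, Finset.sum_filter, ← Finset.sum_neg_distrib]
  refine Finset.sum_congr rfl fun e he => ?_
  rw [← Finset.sum_sub_distrib]
  split_ifs with ht
  · rw [freeAt, ← Finset.sum_neg_distrib]
    refine Finset.sum_congr rfl fun R _ => ?_
    rw [freeProbSnoc, if_pos ht, Finset.card_erase_of_mem he]
    ring
  · rw [neg_zero]
    refine (Finset.sum_eq_zero fun R _ => ?_).symm
    rw [freeProbSnoc, if_neg ht]
    ring

end Greedy

/-! ### Tree-like exploration under large girth -/

theorem adj_unique_of_path {V : Type*} [DecidableEq V] {G : SimpleGraph V} {A : Finset V} {g : ℕ} (hg : (g : ℕ∞) ≤ G.egirth)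
    (hA : A.card + 1 < g) {a x b : V} (hb : b ∉ A) (hab : G.Adj a b) (hxb : G.Adj x b)
    {p : G.Walk x a} (hp : p.IsPath) (hpA : ∀ y ∈ p.support, y ∈ A) : x = a := by
  by_contra hne
  have hbp : b ∉ p.support := fun h => hb (hpA b h)
  -- Otherwise `b` closes the path into a cycle; the path has at most `A.card - 1` edges, so the
  -- cycle has length at most `A.card + 1 < g`.
  have hc : (SimpleGraph.Walk.cons hxb.symm (p.concat hab)).IsCycle := by
    refine (SimpleGraph.Walk.cons_isCycle_iff _ _).2 ⟨hp.concat hbp hab, ?_⟩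
    rw [SimpleGraph.Walk.edges_concat, List.concat_eq_append, List.mem_append, not_or]
    refine ⟨fun h => hbp (p.fst_mem_support_of_mem_edges h), ?_⟩
    rw [List.mem_singleton, Sym2.eq_swap, Sym2.congr_left]
    exact hne
  have h1 := hg.trans (SimpleGraph.egirth_le_length hc)
  rw [SimpleGraph.Walk.length_cons, SimpleGraph.Walk.length_concat] at h1
  have h2 : g ≤ p.length + 1 + 1 := by exact_mod_cast h1
  have h3 : p.support.toFinset.card ≤ A.card :=
    Finset.card_le_card fun y hy => hpA y (List.mem_toFinset.1 hy)
  rw [List.toFinset_card_of_nodup hp.support_nodup, SimpleGraph.Walk.length_support] at h3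
  omega

section Exploration

variable {V : Type*} [Fintype V] [DecidableEq V]

/-- `A` is a set of `k` nodes, connected in `G`, and `S` consists of the edges of `G` that are not
inside `A`, of which `k (r - 2) + 2` have an end node in `A`. -/
structure IsExplored (G : SimpleGraph V) [DecidableRel G.Adj] (r k : ℕ) (S : Finset (Sym2 V))
    (A : Finset V) : Prop where
  mem_iff : ∀ e, e ∈ S ↔ e ∈ G.edgeFinset ∧ ¬ ∀ v ∈ e, v ∈ A
  connected : ∀ a ∈ A, ∀ b ∈ A, ∃ p : G.Walk a b, p.IsPath ∧ ∀ x ∈ p.support, x ∈ A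
  card_eq : A.card = k
  card_boundary : ((S.filter fun e => ∃ v ∈ A, v ∈ e).card : ℝ) = k * ((r : ℝ) - 2) + 2

variable {G : SimpleGraph V} [DecidableRel G.Adj] {r k : ℕ}

theorem isExplored_singleton (hG : G.IsRegularOfDegree r) (v : V) :
    IsExplored G r 1 G.edgeFinset {v} where
  mem_iff e := by
    refine ⟨fun he => ⟨he, fun h => ?_⟩, fun h => h.1⟩
    induction e with
    | _ a b =>
      have ha := h a (by simp)
      have hb := h b (by simp)
      simp only [Finset.mem_singleton] at ha hb
      subst ha hb
      simp at he
  connected a ha b hb := by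
    obtain rfl := Finset.mem_singleton.1 ha
    obtain rfl := Finset.mem_singleton.1 hb
    exact ⟨.nil, .nil, by simp⟩
  card_eq := Finset.card_singleton v
  card_boundary := by
    have : (G.edgeFinset.filter fun e => ∃ w ∈ ({v} : Finset V), w ∈ e) = G.incidenceFinset v := by
      ext e
      simp [SimpleGraph.incidenceSet]
    rw [this, G.card_incidenceFinset_eq_degree, hG.degree_eq]
    push_cast; ring

/-- The new node `b` has only one neighbour in `A`. Hence `e` is the only edge that becomes
internal, and the boundary loses `e` and gains the other `r - 1` edges at `b`. -/
theorem IsExplored.step {S : Finset (Sym2 V)} {A : Finset V} (h : IsExplored G r k S A)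
    (hG : G.IsRegularOfDegree r) {g : ℕ} (hg : (g : ℕ∞) ≤ G.egirth) (hk : k + 1 < g)
    {e : Sym2 V} (he : e ∈ S) (heA : ∃ v ∈ A, v ∈ e) :
    IsExplored G r (k + 1) (S.erase e) (A ∪ e.toFinset) := by
  obtain ⟨a, ha, b, rfl⟩ := heA
  have heG := (h.mem_iff _).1 he
  have hab : G.Adj a b := by simpa using heG.1
  have hb : b ∉ A := fun hb => heG.2 (by simp [ha, hb])
  have hU : A ∪ s(a, b).toFinset = insert b A := by
    ext x; simp only [Finset.mem_union, Sym2.mem_toFinset, Sym2.mem_iff, Finset.mem_insert]; grind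
  have huniq : ∀ x ∈ A, G.Adj x b → x = a := fun x hx hxb => by
    obtain ⟨p, hp, hpA⟩ := h.connected x hx a ha
    exact adj_unique_of_path hg (h.card_eq.symm ▸ hk) hb hab hxb hp hpA
  have hedge : ∀ f ∈ G.edgeFinset, b ∈ f → (∃ v ∈ A, v ∈ f) → f = s(a, b) := by
    rintro f hf hbf ⟨x, hx, hxf⟩
    have hxb : x ≠ b := fun h => hb (h ▸ hx)
    obtain rfl := (Sym2.mem_and_mem_iff hxb).1 ⟨hxf, hbf⟩
    rw [huniq x hx (by simpa using hf)]
  rw [hU]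
  refine ⟨fun f => ?_, ?_, by rw [Finset.card_insert_of_notMem hb, h.card_eq], ?_⟩
  · rw [Finset.mem_erase, h.mem_iff]
    constructor
    · rintro ⟨hfe, hfG, hfA⟩
      refine ⟨hfG, fun hall => ?_⟩
      push Not at hfA
      obtain ⟨x, hxf, hxA⟩ := hfA
      obtain rfl : x = b := (Finset.mem_insert.1 (hall x hxf)).resolve_right hxA
      obtain ⟨y, rfl⟩ := hxf
      have hyb : G.Adj x y := by simpa using hfG
      have hy := (Finset.mem_insert.1 (hall y (by simp))).resolve_left hyb.ne'
      exact hfe (hedge _ hfG (by simp) ⟨y, hy, by simp⟩)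
    · rintro ⟨hfG, hfA⟩
      refine ⟨?_, hfG, fun hall => hfA fun v hv => Finset.mem_insert_of_mem (hall v hv)⟩
      rintro rfl
      exact hfA (by simp [ha])
  · have hto : ∀ x ∈ A, ∃ p : G.Walk x b, p.IsPath ∧ ∀ y ∈ p.support, y ∈ insert b A := by
      intro x hx
      obtain ⟨p, hp, hpA⟩ := h.connected x hx a ha
      refine ⟨p.concat hab, hp.concat (fun h => hb (hpA b h)) hab, fun y hy => ?_⟩
      rw [SimpleGraph.Walk.support_concat, List.mem_append,
        List.mem_singleton] at hy
      exact Finset.mem_insert.2 (hy.symm.imp_right (hpA y))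
    intro x hx y hy
    rcases Finset.mem_insert.1 hx with hxb | hxA <;> rcases Finset.mem_insert.1 hy with hyb | hyA
    · subst hxb hyb
      exact ⟨.nil, .nil, by simp⟩
    · subst hxb
      obtain ⟨p, hp, hpA⟩ := hto y hyA
      exact ⟨p.reverse, hp.reverse, fun z hz => hpA z (by simpa using hz)⟩
    · subst hyb
      exact hto x hxA
    · obtain ⟨p, hp, hpA⟩ := h.connected x hxA y hyA
      exact ⟨p, hp, fun z hz => Finset.mem_insert_of_mem (hpA z hz)⟩
  · have hsplit : ((S.erase s(a, b)).filter fun f => ∃ v ∈ insert b A, v ∈ f) =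
        (S.filter fun f => ∃ v ∈ A, v ∈ f).erase s(a, b) ∪
          (G.incidenceFinset b).erase s(a, b) := by
      ext f
      simp only [Finset.mem_filter, Finset.mem_erase, Finset.mem_union,
        SimpleGraph.mem_incidenceFinset, SimpleGraph.incidenceSet, Set.mem_ofPred_eq,
        Finset.exists_mem_insert, h.mem_iff, SimpleGraph.mem_edgeFinset]
      constructor
      · rintro ⟨⟨h1, h2⟩, h3 | h3⟩
        · exact Or.inr ⟨h1, h2.1, h3⟩
        · exact Or.inl ⟨h1, h2, h3⟩
      · rintro (⟨h1, h2, h3⟩ | ⟨h1, h2, h3⟩)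
        · exact ⟨⟨h1, h2⟩, Or.inr h3⟩
        · exact ⟨⟨h1, h2, fun hall => hb (hall b h3)⟩, Or.inl h3⟩
    have hdisj : Disjoint ((S.filter fun f => ∃ v ∈ A, v ∈ f).erase s(a, b))
        ((G.incidenceFinset b).erase s(a, b)) := by
      refine Finset.disjoint_left.2 fun f hf hf' => ?_
      rw [Finset.mem_erase, Finset.mem_filter] at hf
      rw [Finset.mem_erase, SimpleGraph.mem_incidenceFinset] at hf'
      exact hf.1 (hedge f ((h.mem_iff f).1 hf.2.1).1 hf'.2.2 hf.2.2)
    have hmem : s(a, b) ∈ S.filter fun f => ∃ v ∈ A, v ∈ f :=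
      Finset.mem_filter.2 ⟨he, a, ha, by simp⟩
    have hmem' : s(a, b) ∈ G.incidenceFinset b := by
      simp [SimpleGraph.incidenceSet, hab]
    have hpos := Finset.card_pos.2 ⟨_, hmem'⟩
    rw [hsplit, Finset.card_union_of_disjoint hdisj, Finset.card_erase_of_mem hmem,
      Finset.card_erase_of_mem hmem', Nat.cast_add,
      Nat.cast_sub (Finset.card_pos.2 ⟨_, hmem⟩), Nat.cast_sub hpos, h.card_boundary,
      G.card_incidenceFinset_eq_degree, hG.degree_eq]
    push_cast; ring

end Exploration

/-! ### From uncovered nodes to matching size -/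

section Ratio

variable {V : Type*} [Fintype V] [DecidableEq V]

/-- A matching `M` leaves exactly `|V| - 2 |M|` nodes uncovered; take expectations. -/
theorem expectedRatio_eq [Nonempty V] (G : SimpleGraph V) [DecidableRel G.Adj] :
    expectedRatio G =
      (1 - (∑ v, freeProb G.edgeFinset {v}) / (Fintype.card V : ℝ)) / 2 := by
  have hV : (Fintype.card V : ℝ) ≠ 0 := by exact_mod_cast Fintype.card_ne_zero
  have hfree : ∑ v, freeProb G.edgeFinset {v} =
      expect G.edgeFinset fun M => (Fintype.card V : ℝ) - 2 * M.card := by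
    have h1 : ∑ v, freeProb G.edgeFinset {v} = expect G.edgeFinset fun M =>
        ∑ v : V, if ∀ e ∈ M, ¬ ∃ w ∈ ({v} : Finset V), w ∈ e then (1 : ℝ) else 0 := by
      unfold freeProb expect
      rw [Finset.sum_comm]
      simp_rw [Finset.mul_sum]
    rw [h1]
    refine expect_congr fun M hM hd => ?_
    have hcov : (M.biUnion Sym2.toFinset).card = 2 * M.card := by
      rw [Finset.card_biUnion, Finset.sum_congr rfl fun e he =>
        Sym2.card_toFinset_of_not_isDiag e (G.not_isDiag_of_mem_edgeFinset (hM he)),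
        Finset.sum_const, smul_eq_mul, mul_comm]
      intro e he f hf hef
      refine Finset.disjoint_left.2 fun v hv hv' => hd e he f hf hef ⟨v, ?_, ?_⟩
      · simpa using hv
      · simpa using hv'
    have hcompl : (Finset.univ.filter fun v : V =>
        ∀ e ∈ M, ¬ ∃ w ∈ ({v} : Finset V), w ∈ e) = (M.biUnion Sym2.toFinset)ᶜ := by
      ext v; simp
    have hle : (M.biUnion Sym2.toFinset).card ≤ Fintype.card V := Finset.card_le_univ _
    rw [Finset.sum_boole, hcompl, Finset.card_compl, Nat.cast_sub hle, hcov]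
    push_cast; ring
  have hlin : expect G.edgeFinset (fun M => (Fintype.card V : ℝ) - 2 * M.card) =
      Fintype.card V - 2 * expect G.edgeFinset fun M => (M.card : ℝ) := by
    rw [← expect_const G.edgeFinset (Fintype.card V : ℝ)]
    simp only [expect, mul_sub, Finset.sum_sub_distrib, Finset.mul_sum]
    congr 1
    · simp only [← Finset.sum_mul, ← Finset.mul_sum]
      have := expect_const G.edgeFinset (1 : ℝ)
      simp only [expect, mul_one] at this
      rw [this]; ring
    · exact Finset.sum_congr rfl fun M _ => by ring
  have hr : expectedRatio G =
      (expect G.edgeFinset fun M => (M.card : ℝ)) / (Fintype.card V : ℝ) := by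
    simp only [expectedRatio, greedyMatching, expect, Finset.sum_div, mul_div_assoc]
  rw [hr, hfree, hlin]
  field_simp
  ring

end Ratio

/-! ### Regular graphs of large girth -/

section Girth

/-- The nodes of the ball of radius `d` in the `r`-regular tree with properly coloured edges. -/
abbrev ReducedWord (r d : ℕ) : Type :=
  {l : List (Fin r) // l.IsChain (· ≠ ·) ∧ l.length ≤ d}

instance (r d : ℕ) : Finite (ReducedWord r d) :=
  ((List.finite_length_le (Fin r) d).subset fun _ h => h.2).to_subtype

variable {r d : ℕ}

/-- Move along the edge of colour `i`, or stay if there is none. -/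
def flipLetter (d : ℕ) (i : Fin r) (l : List (Fin r)) : List (Fin r) :=
  if l.head? = some i then l.tail else if l.length < d then i :: l else l

theorem flipLetter_mem (i : Fin r) {l : List (Fin r)}
    (h : l.IsChain (· ≠ ·) ∧ l.length ≤ d) :
    (flipLetter d i l).IsChain (· ≠ ·) ∧ (flipLetter d i l).length ≤ d := by
  unfold flipLetter
  split_ifs with h1 h2
  · exact ⟨h.1.tail, by rw [List.length_tail]; omega⟩
  · refine ⟨List.isChain_cons.2 ⟨fun y hy hiy => h1 ?_, h.1⟩, by simpa using h2⟩
    rw [hiy]; exact hy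
  · exact h

theorem flipLetter_flipLetter (i : Fin r) {l : List (Fin r)}
    (h : l.IsChain (· ≠ ·) ∧ l.length ≤ d) : flipLetter d i (flipLetter d i l) = l := by
  by_cases h1 : l.head? = some i
  · obtain ⟨t, rfl⟩ : ∃ t, l = i :: t := by
      cases l with
      | nil => simp at h1
      | cons a t => simp at h1; exact ⟨t, by rw [h1]⟩
    have h2 : t.head? ≠ some i := fun ht => (List.isChain_cons.1 h.1).1 i ht rfl
    have h3 : t.length < d := by have := h.2; simp at this; omega
    simp [flipLetter, h2, h3]
  · by_cases h2 : l.length < d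
    · simp [flipLetter, h1, h2]
    · simp [flipLetter, h1, h2]

/-- The involution of the ball given by the edges of colour `i`. -/
def flipPerm (d : ℕ) (i : Fin r) : Equiv.Perm (ReducedWord r d) where
  toFun l := ⟨flipLetter d i l.1, flipLetter_mem i l.2⟩
  invFun l := ⟨flipLetter d i l.1, flipLetter_mem i l.2⟩
  left_inv l := Subtype.ext (flipLetter_flipLetter i l.2)
  right_inv l := Subtype.ext (flipLetter_flipLetter i l.2)

theorem flipPerm_mul_self (i : Fin r) : flipPerm d i * flipPerm d i = 1 :=
  Equiv.ext fun l => Subtype.ext (flipLetter_flipLetter i l.2)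

/-- The generators spell the word `l` when applied to the root, so no non-empty reduced word of
length at most `d` is a relation. -/
theorem prod_flipPerm_apply_nil {l : List (Fin r)} (hl : l.IsChain (· ≠ ·))
    (hd : l.length ≤ d) :
    ((l.map (flipPerm d)).prod ⟨[], .nil, Nat.zero_le d⟩).1 = l := by
  induction l with
  | nil => rfl
  | cons i t ih =>
    rw [List.map_cons, List.prod_cons, Equiv.Perm.mul_apply]
    have ht := ih hl.tail (by simp at hd; omega)
    have h2 : t.head? ≠ some i := fun ht => (List.isChain_cons.1 hl).1 i ht rfl
    have h3 : t.length < d := by simp at hd; omega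
    change flipLetter d i _ = _
    rw [ht]
    simp [flipLetter, h2, h3]

theorem flipPerm_injective (hd : 1 ≤ d) : Function.Injective (flipPerm (r := r) d) := by
  intro i j hij
  have h (i : Fin r) := prod_flipPerm_apply_nil (d := d) (l := [i]) (by simp) (by simpa using hd)
  have hi := h i
  rw [List.map_singleton, hij, ← List.map_singleton (f := flipPerm d), h j] at hi
  simpa using hi.symm

theorem flipPerm_ne_one (hd : 1 ≤ d) (i : Fin r) : flipPerm d i ≠ 1 := by
  intro h1
  have h := prod_flipPerm_apply_nil (d := d) (l := [i]) (by simp) (by simpa using hd)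
  rw [List.map_singleton, h1] at h
  simp at h

/-- The Cayley graph of the permutations of the ball with respect to the involutions. -/
def cayleyGraph (r d : ℕ) : SimpleGraph (Equiv.Perm (ReducedWord r d)) :=
  SimpleGraph.fromRel fun x y => ∃ i : Fin r, y = x * flipPerm d i

theorem cayleyGraph_adj (hd : 1 ≤ d) {x y : Equiv.Perm (ReducedWord r d)} :
    (cayleyGraph r d).Adj x y ↔ ∃ i, y = x * flipPerm d i := by
  rw [cayleyGraph, SimpleGraph.fromRel_adj]
  constructor
  · rintro ⟨-, h | ⟨i, hi⟩⟩
    · exact h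
    · exact ⟨i, by rw [hi, mul_assoc, flipPerm_mul_self, mul_one]⟩
  · rintro ⟨i, rfl⟩
    exact ⟨fun h => flipPerm_ne_one hd i (mul_eq_left.1 h.symm), Or.inl ⟨i, rfl⟩⟩

theorem cayleyGraph_regular (hd : 1 ≤ d) [(cayleyGraph r d).LocallyFinite] :
    (cayleyGraph r d).IsRegularOfDegree r := by
  intro x
  have hinj : Function.Injective fun i : Fin r => x * flipPerm d i :=
    fun i j h => flipPerm_injective hd (mul_left_cancel h)
  have h : (cayleyGraph r d).neighborFinset x = Finset.univ.map ⟨_, hinj⟩ := by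
    ext y
    simp [cayleyGraph_adj hd, eq_comm]
  rw [← SimpleGraph.card_neighborFinset_eq_degree, h, Finset.card_map, Finset.card_univ,
    Fintype.card_fin]

/-- Equal consecutive colours would traverse the same edge twice. The clause on `l.head?` carries
the first edge through the induction to rule this out. -/
theorem exists_word_of_isTrail (hd : 1 ≤ d) {x y : Equiv.Perm (ReducedWord r d)}
    (p : (cayleyGraph r d).Walk x y) (hp : p.IsTrail) :
    ∃ l : List (Fin r), l.IsChain (· ≠ ·) ∧ l.length = p.length ∧
      y = x * (l.map (flipPerm d)).prod ∧ ∀ i ∈ l.head?, s(x, x * flipPerm d i) ∈ p.edges := by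
  induction p with
  | nil => exact ⟨[], .nil, rfl, by simp, by simp⟩
  | @cons x z y h p ih =>
    obtain ⟨hp, hxz⟩ := (SimpleGraph.Walk.isTrail_cons _ _).1 hp
    obtain ⟨l, hl, hlen, hy, hhead⟩ := ih hp
    obtain ⟨i, rfl⟩ := (cayleyGraph_adj hd).1 h
    refine ⟨i :: l, List.isChain_cons.2 ⟨fun j hj hij => hxz ?_, hl⟩, by simp [hlen], ?_, ?_⟩
    · have := hhead j hj
      rwa [← hij, mul_assoc, flipPerm_mul_self, mul_one, Sym2.eq_swap] at this
    · rw [hy, List.map_cons, List.prod_cons, mul_assoc]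
    · intro j hj
      obtain rfl : i = j := by simpa using hj
      simp

theorem le_egirth_cayleyGraph (hd : 1 ≤ d) : (d : ℕ∞) ≤ (cayleyGraph r d).egirth := by
  rw [SimpleGraph.le_egirth]
  intro x w hw
  by_contra hlt
  have hlt : w.length < d := by exact_mod_cast not_le.1 hlt
  obtain ⟨l, hl, hlen, hx, -⟩ := exists_word_of_isTrail hd w hw.isTrail
  have h := prod_flipPerm_apply_nil (d := d) hl (by omega)
  rw [mul_eq_left.1 hx.symm] at h
  have h0 : l = [] := h.symm
  have := hw.three_le_length
  simp [h0] at hlen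
  omega

end Girth

/-- Needed because `sInf` and `sSup` of the empty set are 0 in ℝ. The radius `g + 1` stays positive
when `g = 0`. -/
theorem ratios_nonempty (g r : ℕ) : (ratios g r).Nonempty := by
  classical
  have : Fintype (ReducedWord r (g + 1)) := Fintype.ofFinite _
  refine ⟨_, Equiv.Perm (ReducedWord r (g + 1)), inferInstance, inferInstance,
    cayleyGraph r (g + 1), cayleyGraph_regular (by omega), ?_, rfl⟩
  refine le_trans ?_ (le_egirth_cayleyGraph (by omega))
  exact_mod_cast Nat.le_succ g

/-! ### Convergence to the limit system -/

section Limit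

/-- Differentiation shifts `k` to `k + 1`. With `α = 2 / (r - 2)` and `b = ±(r - 2)` the factor is,
up to sign, the boundary size; one sign gives the limit system, the other the comparison system. -/
theorem hasDerivAt_affine_rpow {a b α : ℝ} (k : ℕ) {x : ℝ} (hx : 0 < a + b * x) :
    HasDerivAt (fun u : ℝ => (a + b * u) ^ (-((k : ℝ) + α)))
      (-(b * (k + α)) * (a + b * x) ^ (-(((k + 1 : ℕ) : ℝ) + α))) x := by
  have h1 : HasDerivAt (fun u : ℝ => a + b * u) b x := by
    simpa using ((hasDerivAt_id x).const_mul b).const_add a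
  convert h1.rpow_const (p := -((k : ℝ) + α)) (Or.inl hx.ne') using 1
  rw [show -(((k + 1 : ℕ) : ℝ) + α) = -((k : ℝ) + α) - 1 by push_cast; ring]
  ring

/-- The limit of `freeAt` on explored sets of `k` nodes. -/
noncomputable def limitProb (r k : ℕ) (u : ℝ) : ℝ :=
  (1 + ((r : ℝ) - 2) * u) ^ (-((k : ℝ) + 2 / ((r : ℝ) - 2)))

/-- For large girth, the values of `freeAt` at `u` on explored sets are close to the limit. -/
def IsCloseAt (r : ℕ) (u : ℝ) : Prop :=
  ∀ (k : ℕ) (ε : ℝ), 0 < ε → ∃ g : ℕ, ∀ (V : Type) [Fintype V] [DecidableEq V]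
    (G : SimpleGraph V) [DecidableRel G.Adj], G.IsRegularOfDegree r → (g : ℕ∞) ≤ G.egirth →
    ∀ (S : Finset (Sym2 V)) (A : Finset V), IsExplored G r k S A →
      |freeAt S A u - limitProb r k u| ≤ ε

theorem isCloseAt_zero (r : ℕ) : IsCloseAt r 0 := by
  refine fun k ε hε => ⟨0, fun V _ _ G _ _ _ S A _ => ?_⟩
  simp [freeAt_zero, limitProb, hε.le]

variable {r : ℕ}

theorem limitProb_nonneg (hr : 3 ≤ r) (k : ℕ) {u : ℝ} (hu : 0 ≤ u) : 0 ≤ limitProb r k u := by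
  have hm : (0 : ℝ) < r - 2 := by
    have : (3 : ℝ) ≤ r := by exact_mod_cast hr
    linarith
  exact Real.rpow_nonneg (by positivity) _

theorem limitProb_le_one (hr : 3 ≤ r) (k : ℕ) {u : ℝ} (hu : 0 ≤ u) : limitProb r k u ≤ 1 := by
  have hm : (0 : ℝ) < r - 2 := by
    have : (3 : ℝ) ≤ r := by exact_mod_cast hr
    linarith
  refine Real.rpow_le_one_of_one_le_of_nonpos (le_add_of_nonneg_right (by positivity)) ?_
  exact neg_nonpos.2 (by positivity)

/-- Descending induction over the size of the explored set: the differences to the limit stay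
below a solution of the comparison system. -/
theorem abs_freeAt_sub_limitProb_le (hr : 3 ≤ r) {V : Type} [Fintype V] [DecidableEq V]
    {G : SimpleGraph V} [DecidableRel G.Adj] (hG : G.IsRegularOfDegree r) {g K : ℕ}
    (hg : (g : ℕ∞) ≤ G.egirth) (hK : K + 1 < g) {T s η : ℝ} (hT : 0 ≤ T) (hs1 : s ≤ 1)
    (hs : ((r : ℝ) - 2) * (s - T) ≤ 1 / 4) (hη : 0 < η) (hηK : 1 ≤ η * 2 ^ K)
    (hinit : ∀ j ≤ K, ∀ S A, IsExplored G r j S A → |freeAt S A T - limitProb r j T| ≤ η)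
    (i j : ℕ) (hij : j + i = K) (S : Finset (Sym2 V)) (A : Finset V)
    (hSA : IsExplored G r j S A) {x : ℝ} (hx : x ∈ Set.Icc T s) :
    |freeAt S A x - limitProb r j x| ≤
      η * ((1 / 2 + (r - 2) * T) + (-((r : ℝ) - 2)) * x) ^ (-((j : ℝ) + 2 / ((r : ℝ) - 2))) := by
  have hm : (0 : ℝ) < r - 2 := by
    have : (3 : ℝ) ≤ r := by exact_mod_cast hr
    linarith
  have hα : (0 : ℝ) < 2 / ((r : ℝ) - 2) := by positivity
  have hpos : ∀ x ∈ Set.Icc T s, 0 < (1 / 2 + (r - 2) * T) + (-((r : ℝ) - 2)) * x := by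
    intro x hx
    nlinarith [mul_le_mul_of_nonneg_left hx.2 hm.le]
  have hhalf : ∀ x ∈ Set.Icc T s, (1 / 2 + (r - 2) * T) + (-((r : ℝ) - 2)) * x ≤ 1 / 2 := by
    intro x hx
    nlinarith [mul_le_mul_of_nonneg_left hx.1 hm.le]
  -- The base lies in (0, 1/2], so level `n` of the comparison is at least `η * 2 ^ n`: enough for
  -- the initial error `η` at `T` and for the trivial error 1 at level `K`.
  have hlow : ∀ (n : ℕ), ∀ x ∈ Set.Icc T s, (2 : ℝ) ^ n ≤
      ((1 / 2 + (r - 2) * T) + (-((r : ℝ) - 2)) * x) ^ (-((n : ℝ) + 2 / ((r : ℝ) - 2))) := by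
    intro n x hx
    calc (2 : ℝ) ^ n = (1 / 2 : ℝ) ^ (-(n : ℝ)) := by
          rw [one_div, Real.inv_rpow (by norm_num), Real.rpow_neg (by norm_num), inv_inv,
            Real.rpow_natCast]
      _ ≤ (1 / 2 : ℝ) ^ (-((n : ℝ) + 2 / ((r : ℝ) - 2))) :=
          Real.rpow_le_rpow_of_exponent_ge (by norm_num) (by norm_num) (by linarith)
      _ ≤ _ := Real.rpow_le_rpow_of_nonpos (hpos x hx) (hhalf x hx)
          (neg_nonpos.2 (by positivity))
  induction i generalizing j S A x with
  | zero =>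
    obtain rfl : j = K := by omega
    have hx0 : 0 ≤ x := hT.trans hx.1
    have hx1 : x ≤ 1 := hx.2.trans hs1
    refine le_trans ?_ (hηK.trans (mul_le_mul_of_nonneg_left (hlow j x hx) hη.le))
    have h1 := freeAt_nonneg S A hx0 hx1
    have h2 := freeAt_le_one S A hx0 hx1
    have h3 := limitProb_nonneg hr j hx0
    have h4 := limitProb_le_one hr j hx0
    exact abs_le.2 ⟨by linarith, by linarith⟩
  | succ i ih =>
    -- The number of boundary edges is the coefficient in the limit system, so the derivative of the
    -- limit can be distributed over these edges.
    have hderiv : ∀ y ∈ Set.Icc T s, HasDerivAt (fun u => freeAt S A u - limitProb r j u)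
        (-∑ e ∈ S with ∃ v ∈ A, v ∈ e,
          (freeAt (S.erase e) (A ∪ e.toFinset) y - limitProb r (j + 1) y)) y := by
      intro y hy
      have hy0 : 0 < 1 + ((r : ℝ) - 2) * y := by
        have := hT.trans hy.1
        positivity
      refine ((hasDerivAt_freeAt S A y).sub (hasDerivAt_affine_rpow j hy0)).congr_deriv ?_
      rw [Finset.sum_sub_distrib, Finset.sum_const, nsmul_eq_mul, hSA.card_boundary, limitProb]
      field_simp
      ring
    have hB : ∀ y ∈ Set.Icc T s, HasDerivAt
        (fun u => η * ((1 / 2 + (r - 2) * T) + (-((r : ℝ) - 2)) * u) ^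
          (-((j : ℝ) + 2 / ((r : ℝ) - 2))))
        ((j * ((r : ℝ) - 2) + 2) * (η * ((1 / 2 + (r - 2) * T) + (-((r : ℝ) - 2)) * y) ^
          (-(((j + 1 : ℕ) : ℝ) + 2 / ((r : ℝ) - 2))))) y := by
      intro y hy
      refine ((hasDerivAt_affine_rpow j (hpos y hy)).const_mul η).congr_deriv ?_
      field_simp
    refine image_norm_le_of_norm_deriv_right_le_deriv_boundary'
      (fun y hy => (hderiv y hy).continuousAt.continuousWithinAt)
      (fun y hy => (hderiv y (Set.Ico_subset_Icc_self hy)).hasDerivWithinAt) ?_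
      (fun y hy => (hB y hy).continuousAt.continuousWithinAt)
      (fun y hy => (hB y (Set.Ico_subset_Icc_self hy)).hasDerivWithinAt) ?_ hx
    · have hTm : T ∈ Set.Icc T s := Set.left_mem_Icc.2 (hx.1.trans hx.2)
      refine (hinit j (by omega) S A hSA).trans (le_mul_of_one_le_right hη.le ?_)
      exact (one_le_pow₀ (by norm_num)).trans (hlow j T hTm)
    · intro y hy
      rw [norm_neg, ← hSA.card_boundary, ← nsmul_eq_mul]
      refine (norm_sum_le _ _).trans (Finset.sum_le_card_nsmul _ _ _ fun e he => ?_)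
      rw [Finset.mem_filter] at he
      exact ih (j + 1) (by omega) _ _ (hSA.step hG hg (by omega) he.1 he.2)
        (Set.Ico_subset_Icc_self hy)

theorem IsCloseAt.step (hr : 3 ≤ r) {T s : ℝ} (h : IsCloseAt r T) (hT : 0 ≤ T) (hTs : T ≤ s)
    (hs1 : s ≤ 1) (hs : ((r : ℝ) - 2) * (s - T) ≤ 1 / 4) : IsCloseAt r s := by
  have hm : (0 : ℝ) < r - 2 := by
    have : (3 : ℝ) ≤ r := by exact_mod_cast hr
    linarith
  intro k ε hε
  -- At time `s` the base of the comparison function is still at least 1/4, so `C` bounds the growth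
  -- of the error at level `k`.
  set C : ℝ := (1 / 4 : ℝ) ^ (-((k : ℝ) + 2 / ((r : ℝ) - 2))) with hC
  have hC0 : 0 < C := Real.rpow_pos_of_pos (by norm_num) _
  set η := ε / C with hηdef
  have hη : 0 < η := by positivity
  obtain ⟨N, hN⟩ := pow_unbounded_of_one_lt (1 / η) (one_lt_two : (1 : ℝ) < 2)
  set K := k + N with hKdef
  have hηK : 1 ≤ η * 2 ^ K := by
    rw [div_lt_iff₀ hη] at hN
    have : (2 : ℝ) ^ N ≤ 2 ^ K := pow_le_pow_right₀ (by norm_num) (by omega)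
    nlinarith
  choose gj hgj using fun j : ℕ => h j η hη
  refine ⟨(Finset.range (K + 1)).sup gj + K + 2, fun V _ _ G _ hG hg S A hSA => ?_⟩
  have hinit : ∀ j ≤ K, ∀ S A, IsExplored G r j S A →
      |freeAt S A T - limitProb r j T| ≤ η := by
    intro j hj S A hSA
    refine hgj j V G hG (le_trans ?_ hg) S A hSA
    have : gj j ≤ (Finset.range (K + 1)).sup gj := Finset.le_sup (Finset.mem_range.2 (by omega))
    exact_mod_cast (by omega : gj j ≤ (Finset.range (K + 1)).sup gj + K + 2)
  refine (abs_freeAt_sub_limitProb_le hr hG hg (by omega) hT hs1 hs hη hηK hinit N k rfl S A hSA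
    (Set.right_mem_Icc.2 hTs)).trans ?_
  calc _ ≤ η * C := by
        refine mul_le_mul_of_nonneg_left ?_ hη.le
        refine Real.rpow_le_rpow_of_nonpos (by norm_num) (by linarith) ?_
        exact neg_nonpos.2 (by positivity)
    _ = ε := div_mul_cancel₀ ε hC0.ne'

/-- Induction on the number of time steps of length `1 / (4 (r - 2))`. -/
theorem isCloseAt_of_mem_Icc (hr : 3 ≤ r) {u : ℝ} (hu : u ∈ Set.Icc (0 : ℝ) 1) :
    IsCloseAt r u := by
  have hm : (0 : ℝ) < r - 2 := by
    have : (3 : ℝ) ≤ r := by exact_mod_cast hr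
    linarith
  obtain ⟨n, hn⟩ := exists_nat_ge (((r : ℝ) - 2) * u * 4)
  induction n generalizing u with
  | zero =>
    have : u = 0 := by
      have h0 := hu.1
      push_cast at hn
      nlinarith
    exact this ▸ isCloseAt_zero r
  | succ n ih =>
    rcases le_total (1 / 4 / ((r : ℝ) - 2)) u with h | h
    · have h4 : ((r : ℝ) - 2) * (1 / 4 / ((r : ℝ) - 2)) = 1 / 4 := by field_simp
      have hp : 0 < 1 / 4 / ((r : ℝ) - 2) := by positivity
      refine (ih (u := u - 1 / 4 / ((r : ℝ) - 2)) ⟨by linarith, by linarith [hu.2]⟩ ?_).step hr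
        (by linarith) (by linarith) hu.2 ?_
      · push_cast at hn
        linarith [mul_sub ((r : ℝ) - 2) u (1 / 4 / ((r : ℝ) - 2))]
      · rw [sub_sub_cancel, h4]
    · refine (isCloseAt_zero r).step hr le_rfl hu.1 hu.2 ?_
      rw [le_div_iff₀ hm] at h
      linarith

theorem limitProb_one_one (hr : 3 ≤ r) :
    limitProb r 1 1 = ((r : ℝ) - 1) ^ (-((r : ℝ) / ((r : ℝ) - 2))) := by
  have hm : (r : ℝ) - 2 ≠ 0 := by
    have : (3 : ℝ) ≤ r := by exact_mod_cast hr
    linarith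
  rw [limitProb]
  congr 1
  · ring
  · field_simp
    push_cast; ring

theorem exists_forall_ratios_abs_sub_le (hr : 3 ≤ r) {ε : ℝ} (hε : 0 < ε) :
    ∃ g₀ : ℕ, ∀ g ≥ g₀, ∀ x ∈ ratios g r,
      |x - (1 - ((r : ℝ) - 1) ^ (-((r : ℝ) / ((r : ℝ) - 2)))) / 2| ≤ ε := by
  classical
  obtain ⟨g₀, hg₀⟩ := isCloseAt_of_mem_Icc hr (Set.right_mem_Icc.2 zero_le_one) 1 ε hε
  refine ⟨g₀, ?_⟩
  rintro g hg x ⟨V, _, _, G, hG, hgirth, rfl⟩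
  have hV : (0 : ℝ) < Fintype.card V := by exact_mod_cast Fintype.card_pos
  have hv : ∀ v : V, |freeProb G.edgeFinset {v} - limitProb r 1 1| ≤ ε := fun v => by
    rw [← freeAt_one]
    refine hg₀ V G hG (le_trans (by exact_mod_cast hg) hgirth) _ _ (isExplored_singleton hG v)
  rw [expectedRatio_eq, ← limitProb_one_one hr]
  have havg : |(∑ v, freeProb G.edgeFinset {v}) / (Fintype.card V : ℝ) - limitProb r 1 1| ≤ ε := by
    have heq : (∑ v, freeProb G.edgeFinset {v}) / (Fintype.card V : ℝ) - limitProb r 1 1 =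
        (∑ v, (freeProb G.edgeFinset {v} - limitProb r 1 1)) / (Fintype.card V : ℝ) := by
      rw [Finset.sum_sub_distrib, Finset.sum_const, nsmul_eq_mul, Finset.card_univ]
      field_simp
    rw [heq, abs_div, abs_of_pos hV, div_le_iff₀ hV]
    refine (Finset.abs_sum_le_sum_abs _ _).trans ?_
    refine (Finset.sum_le_card_nsmul _ _ ε fun v _ => hv v).trans (le_of_eq ?_)
    rw [nsmul_eq_mul, Finset.card_univ, mul_comm]
  rw [abs_le] at havg ⊢
  constructor <;> linarith [havg.1, havg.2]

/-! ### Limits in the girth and in the degree -/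

theorem tendsto_infRatio (hr : 3 ≤ r) :
    Tendsto (fun g : ℕ => infRatio g r) atTop
      (𝓝 ((1 - ((r : ℝ) - 1) ^ (-((r : ℝ) / ((r : ℝ) - 2)))) / 2)) := by
  rw [Metric.tendsto_atTop]
  intro ε hε
  obtain ⟨g₀, hg₀⟩ := exists_forall_ratios_abs_sub_le hr (half_pos hε)
  refine ⟨g₀, fun g hg => ?_⟩
  have h := fun x hx => abs_le.1 (hg₀ g hg x hx)
  obtain ⟨x, hx⟩ := ratios_nonempty g r
  have h1 : infRatio g r ≤ x := csInf_le ⟨_, fun y hy => le_sub_iff_add_le.1 (h y hy).1⟩ hx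
  have h2 := le_csInf ⟨x, hx⟩ fun y hy => le_sub_iff_add_le.1 (h y hy).1
  have h3 := (h x hx).2
  rw [infRatio] at *
  rw [Real.dist_eq, abs_lt]
  constructor <;> linarith

theorem tendsto_supRatio (hr : 3 ≤ r) :
    Tendsto (fun g : ℕ => supRatio g r) atTop
      (𝓝 ((1 - ((r : ℝ) - 1) ^ (-((r : ℝ) / ((r : ℝ) - 2)))) / 2)) := by
  rw [Metric.tendsto_atTop]
  intro ε hε
  obtain ⟨g₀, hg₀⟩ := exists_forall_ratios_abs_sub_le hr (half_pos hε)
  refine ⟨g₀, fun g hg => ?_⟩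
  have h := fun x hx => abs_le.1 (hg₀ g hg x hx)
  obtain ⟨x, hx⟩ := ratios_nonempty g r
  have h1 : x ≤ supRatio g r := le_csSup ⟨_, fun y hy => sub_le_iff_le_add.1 (h y hy).2⟩ hx
  have h2 := csSup_le ⟨x, hx⟩ fun y hy => sub_le_iff_le_add.1 (h y hy).2
  have h3 := (h x hx).1
  rw [supRatio] at *
  rw [Real.dist_eq, abs_lt]
  constructor <;> linarith

/-- Since `r / (r - 2) ≥ 1`, the power is at most `(r - 1)⁻¹`. -/
theorem tendsto_limit_ratio :
    Tendsto (fun r : ℕ => (1 - ((r : ℝ) - 1) ^ (-((r : ℝ) / ((r : ℝ) - 2)))) / 2) atTop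
      (𝓝 (1 / 2)) := by
  have hinv : Tendsto (fun r : ℕ => ((r : ℝ) - 1)⁻¹) atTop (𝓝 0) :=
    (tendsto_atTop_add_const_right _ (-1) tendsto_natCast_atTop_atTop).inv_tendsto_atTop
  have hpow : Tendsto (fun r : ℕ => ((r : ℝ) - 1) ^ (-((r : ℝ) / ((r : ℝ) - 2)))) atTop
      (𝓝 0) := by
    refine squeeze_zero' ?_ ?_ hinv
    · filter_upwards [eventually_ge_atTop 3] with r hr
      have : (3 : ℝ) ≤ r := by exact_mod_cast hr
      exact Real.rpow_nonneg (by linarith) _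
    · filter_upwards [eventually_ge_atTop 3] with r hr
      have : (3 : ℝ) ≤ r := by exact_mod_cast hr
      rw [← Real.rpow_neg_one]
      refine Real.rpow_le_rpow_of_exponent_le (by linarith) (neg_le_neg ?_)
      rw [le_div_iff₀ (by linarith)]
      linarith
  simpa using (hpow.const_sub 1).div_const 2

end Limit

end GreedyMatching

theorem mainTheorem7 :
    (∀ r : ℕ, 3 ≤ r →
      Tendsto (fun g : ℕ => GreedyMatching.infRatio g r) atTop
        (𝓝 ((1 - ((r : ℝ) - 1) ^ (-((r : ℝ) / ((r : ℝ) - 2)))) / 2)) ∧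
      Tendsto (fun g : ℕ => GreedyMatching.supRatio g r) atTop
        (𝓝 ((1 - ((r : ℝ) - 1) ^ (-((r : ℝ) / ((r : ℝ) - 2)))) / 2))) ∧
    Tendsto (fun r : ℕ => limUnder atTop fun g : ℕ => GreedyMatching.infRatio g r) atTop
      (𝓝 (1 / 2)) ∧
    Tendsto (fun r : ℕ => limUnder atTop fun g : ℕ => GreedyMatching.supRatio g r) atTop
      (𝓝 (1 / 2)) := by
  -- `limUnder` is identified only for `r ≥ 3`, which suffices for the limit in `r`.
  refine ⟨fun r hr => ⟨GreedyMatching.tendsto_infRatio hr, GreedyMatching.tendsto_supRatio hr⟩,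
    GreedyMatching.tendsto_limit_ratio.congr' ?_, GreedyMatching.tendsto_limit_ratio.congr' ?_⟩
  · filter_upwards [eventually_ge_atTop 3] with r hr
    exact (GreedyMatching.tendsto_infRatio hr).limUnder_eq.symm
  · filter_upwards [eventually_ge_atTop 3] with r hr
    exact (GreedyMatching.tendsto_supRatio hr).limUnder_eq.symm
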